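/- Let $\mathfrak{A}$ be an associative algebra (not necessarily unital or commutative) over a field $K$, let $\mathfrak{B}\subseteq\mathfrak{A}$ be a subalgebra, and let $\Phi,\Psi:\mathfrak{A}\to\mathfrak{B}$ be conditional expectations, i.e. $K$-linear $\mathfrak{B}$-bimodule maps that restrict to the identity on $\mathfrak{B}$. **C-freeness.** Elements $X,Y\in\mathfrak{A}$ are *c-free* with respect to $(\Phi,\Psi)$ if the subalgebras $\mathfrak{A}_1$, $\mathfrak{A}_2$ generated by $\mathfrak{B}\cup\{X\}$ and by $\mathfrak{B}\cup\{Y\}$ satisfy: for all $n\ge 1$, all $\varepsilon(1),\dots,\varepsilon(n)\in\{1,2\}$ with $\varepsilon(j)\ne\varepsilon(j+1)$ for $1\le j<n$, and all $a_j\in\mathfrak{A}_{\varepsilon(j)}$ with $\Psi(a_j)=0$, $$\Psi(a_1a_2\cdots a_n)=0,\qquad \Phi(a_1a_2\cdots a_n)=\Phi(a_1)\Phi(a_2)\cdots\Phi(a_n).$$ **Series.** A multilinear function series over $\mathfrak{B}$ (with constant term in $\mathfrak{B}$) is a sequence $\omega=(\omega_0,\omega_1,\omega_2,\dots)$ with $\omega_0\in\mathfrak{B}$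 and $\omega_n:\mathfrak{B}^n\to\mathfrak{B}$ $K$-multilinear for $n\ge1$; series are added termwise. For $X\in\mathfrak{A}$ let $\mathfrak{M}_X$ and $\mathcal{M}_X$ be the moment series of $X$ with respect to $\Phi$ and $\Psi$: $$\mathfrak{M}_{X,n}(b_1,\dots,b_n)=\Phi(Xb_1X\cdots Xb_nX),\qquad \mathcal{M}_{X,n}(b_1,\dots,b_n)=\Psi(Xb_1X\cdots Xb_nX)\qquad(n\ge 0).$$ **The transform.** For series $\beta,\gamma$, let ${}^cR_{\beta,\gamma}$ be the unique multilinear function series $R$ such that for all $n\ge0$ and $b_1,\dots,b_n\in\mathfrak{B}$ $$\beta_n(b_1,\dots,b_n)=S_n(b_1,\dots,b_n)+\sum_{m=0}^{n-1}S_m(b_1,\dots,b_m)\,b_{m+1}\,\beta_{n-m-1}(b_{m+2},\dots,b_n),$$ where $S_0=R_0$ and, for $m\ge1$, $$S_m(b_1,\dots,b_m)=\sum_{k=1}^m\ \sum_{\substack{p_1,\dots,p_k\ge1\\ p_1+\dots+p_k=m}}R_k\big(\sigma_{p_1}(b_1,\dots,b_{p_1}),\sigma_{p_2}(b_{p_1+1},\dots,b_{p_1+p_2}),\dots,\sigma_{p_k}(b_{m-p_k+1},\dots,b_m)\big),$$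 with $\sigma_1(b)=b$ and $\sigma_p(b_1,\dots,b_p)=b_1\,\gamma_{p-2}(b_2,\dots,b_{p-1})\,b_p$ for $p\ge2$. Put ${}^cR_X={}^cR_{\mathfrak{M}_X,\mathcal{M}_X}$. **Theorem.** If $X,Y\in\mathfrak{A}$ are c-free with respect to $(\Phi,\Psi)$, then $${}^cR_{X+Y}={}^cR_X+{}^cR_Y .$$ -/

import Mathlib

namespace CFreeProb

/-! ## Formal multilinear function series -/

section Series

/-- Formal multilinear function series over the `K`-algebra `B`: a sequence of `n`-linear maps
`Bⁿ → B`, one for each `n ≥ 0`, added termwise.  The term of order `0` is an element of `B`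
(a multilinear map on the empty family). -/
abbrev MulSeries (K : Type*) [Field K] (B : Type*) [NonUnitalRing B] [Module K B] : Type _ :=
  (n : ℕ) → MultilinearMap K (fun _ : Fin n => B) B

variable {K : Type*} [Field K] {B : Type*} [NonUnitalRing B] [Module K B]

/-- The expression attached to two consecutive elements of the outer block, with `p` arguments
between them: it is `b₁` for `p = 1`, and `b₁ γ_{p-2}(b₂, …, b_{p-1}) b_p` for `p ≥ 2`.
(The value at `p = 0` is never used.) -/
def bracket (γ : MulSeries K B) : (p : ℕ) → (Fin p → B) → B
  | 0, _ => 0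
  | 1, b => b 0
  | p + 2, b => b 0 * γ p (fun i => b i.succ.castSucc) * b (Fin.last (p + 1))

/-- For `m ≤ n`, the sum over all `k` and all ways to cut `(b₁, …, b_m)` into `k` consecutive
non-empty blocks of `R_k` evaluated at the brackets of the blocks. (For `m = 0` it is `R_0`.) -/
def outerSum (γ R : MulSeries K B) (m : ℕ) (b : Fin m → B) : B :=
  ∑ c : Composition m, R c.length (fun j => bracket γ (c.blocksFun j) (b ∘ c.embedding j))

/-- The recurrence relation which characterizes the conditionally free `R`-transform of the pair
`(β, γ)`: for every `n`,
`β_n(b₁, …, b_n) = ∑_{m ≤ n} ∑ R_k([b₁ γ(…) b_{p₁}], …, [… b_m]) b_{m+1} β_{n-m-1}(b_{m+2}, …, b_n)`,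
where the inner sum is over the cuts of `(b₁, …, b_m)` into `k` consecutive non-empty blocks, and
the factor `b_{m+1} β_{n-m-1}(…)` is absent when `m = n`. -/
def IsCR (β γ R : MulSeries K B) : Prop :=
  ∀ (n : ℕ) (b : Fin n → B),
    β n b = outerSum γ R n b +
      ∑ m : Fin n, outerSum γ R m (fun i => b (i.castLE m.isLt.le)) *
        (b m * β (n - m - 1) (fun i => b ⟨m + 1 + i, by omega⟩))

lemma outerSum_split (γ R : MulSeries K B) (n : ℕ) (b : Fin n → B) :
    outerSum γ R n b = R n b + ∑ c : {c : Composition n // c.length < n},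
      R c.1.length (fun j => bracket γ (c.1.blocksFun j) (b ∘ c.1.embedding j)) := by
  classical
  unfold outerSum
  rw [← Finset.add_sum_erase _ _ (Finset.mem_univ (Composition.ones n))]
  congr 1
  · have key : ∀ (l : ℕ) (h : l = n) (w : Fin l → B), (∀ i, w i = b (Fin.cast h i)) →
        R l w = R n b := by
      rintro l rfl w hw
      congr 1
      funext i
      simpa using hw i
    refine key _ (Composition.ones_length n) _ fun i => ?_
    have hb : ∀ (p : ℕ) (hp : p = 1) (f : Fin p → B), bracket γ p f = f ⟨0, by omega⟩ := by
      rintro p rfl f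
      rfl
    rw [hb _ (Composition.ones_blocksFun n i)]
    simp only [Function.comp]
    rw [Composition.ones_embedding]
    rfl
  · symm
    refine Finset.sum_bij (fun c _ => c.1) ?_ ?_ ?_ ?_
    · intro c _
      simp only [Finset.mem_erase, Finset.mem_univ, and_true]
      intro h
      exact absurd (Composition.eq_ones_iff_length.1 h) c.2.ne
    · intro c _ d _ h
      exact Subtype.ext h
    · intro c hc
      simp only [Finset.mem_erase, Finset.mem_univ, and_true] at hc
      exact ⟨⟨c, lt_of_le_of_ne c.length_le
        (fun h => hc (Composition.eq_ones_iff_length.2 h))⟩, Finset.mem_univ _, rfl⟩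
    · intro c _
      rfl

lemma IsCR.unique {β γ R S : MulSeries K B} (hR : IsCR β γ R) (hS : IsCR β γ S) : R = S := by
  funext n
  induction n using Nat.strong_induction_on with
  | _ n ih =>
    ext b
    have h1 := hR n b
    have h2 := hS n b
    rw [outerSum_split] at h1 h2
    have e1 : ∀ c : {c : Composition n // c.length < n}, R c.1.length = S c.1.length :=
      fun c => ih _ c.2
    have e2 : ∀ (m : Fin n) (w : Fin m → B), outerSum γ R m w = outerSum γ S m w := by
      intro m w
      unfold outerSum
      refine Finset.sum_congr rfl fun c _ => ?_
      rw [ih _ (lt_of_le_of_lt c.length_le m.isLt)]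
    simp only [e1, e2] at h1
    rw [h1] at h2
    simpa using h2

/-- The identity of `B` as a multilinear map in one variable. -/
def idOne : MultilinearMap K (fun _ : Fin 1 => B) B :=
  MultilinearMap.ofSubsingleton K B B (0 : Fin 1) LinearMap.id

lemma idOne_apply (b : Fin 1 → B) : (idOne : MultilinearMap K (fun _ : Fin 1 => B) B) b = b 0 :=
  rfl

variable [IsScalarTower K B B] [SMulCommClass K B B]

/-- The product of two multilinear maps applied to consecutive groups of arguments. -/
noncomputable def concat {k l n : ℕ} (f : MultilinearMap K (fun _ : Fin k => B) B)
    (g : MultilinearMap K (fun _ : Fin l => B) B) (h : k + l = n) :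
    MultilinearMap K (fun _ : Fin n => B) B :=
  ((LinearMap.mul' K B).compMultilinearMap (f.domCoprod g)).domDomCongr
    (finSumFinEquiv.trans (finCongr h))

lemma concat_apply {k l n : ℕ} (f : MultilinearMap K (fun _ : Fin k => B) B)
    (g : MultilinearMap K (fun _ : Fin l => B) B) (h : k + l = n) (b : Fin n → B) :
    concat f g h b = f (fun i => b (Fin.cast h (Fin.castAdd l i))) *
      g (fun i => b (Fin.cast h (Fin.natAdd k i))) := by
  simp [concat]

lemma exists_bracket (γ : MulSeries K B) (p : ℕ) :
    ∃ f : MultilinearMap K (fun _ : Fin p => B) B, ∀ b, f b = bracket γ p b := by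
  match p with
  | 0 => exact ⟨0, fun b => rfl⟩
  | 1 => exact ⟨idOne, fun b => rfl⟩
  | p + 2 =>
    refine ⟨concat (concat idOne (γ p) (Nat.add_comm 1 p)) idOne rfl, fun b => ?_⟩
    rw [concat_apply, concat_apply, idOne_apply, idOne_apply]
    have h : (fun i : Fin p => b (Fin.cast (rfl : p + 1 + 1 = p + 2) (Fin.castAdd 1
        (Fin.cast (Nat.add_comm 1 p) (Fin.natAdd 1 i))))) = fun i => b i.succ.castSucc := by
      funext i
      congr 1
      ext
      simp
    rw [h]
    rfl

/-- The multilinear version of `bracket`. -/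
noncomputable def bracketML (γ : MulSeries K B) (p : ℕ) : MultilinearMap K (fun _ : Fin p => B) B :=
  (exists_bracket γ p).choose

lemma bracketML_apply (γ : MulSeries K B) (p : ℕ) (b : Fin p → B) :
    bracketML γ p b = bracket γ p b :=
  (exists_bracket γ p).choose_spec b

/-- The summand of `outerSum` at a given composition, as a multilinear map. -/
noncomputable def outerTerm (γ : MulSeries K B) {m : ℕ} (c : Composition m)
    (r : MultilinearMap K (fun _ : Fin c.length => B) B) :
    MultilinearMap K (fun _ : Fin m => B) B :=
  MultilinearMap.domDomCongr c.blocksFinEquiv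
    (r.compMultilinearMap (N := fun _ _ => B) (fun j => bracketML γ (c.blocksFun j)))

lemma outerTerm_apply (γ : MulSeries K B) {m : ℕ} (c : Composition m)
    (r : MultilinearMap K (fun _ : Fin c.length => B) B) (b : Fin m → B) :
    outerTerm γ c r b = r (fun j => bracket γ (c.blocksFun j) (b ∘ c.embedding j)) := by
  simp only [outerTerm, MultilinearMap.domDomCongr_apply, MultilinearMap.compMultilinearMap_apply,
    bracketML_apply]
  rfl

/-- The solution of the recurrence relation `IsCR`, by recursion on the order. -/
noncomputable def solveCR (β γ : MulSeries K B) (n : ℕ) : MultilinearMap K (fun _ : Fin n => B) B :=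
  β n - (∑ c : {c : Composition n // c.length < n}, outerTerm γ c.1 (solveCR β γ c.1.length))
    - ∑ m : Fin n, concat (concat (∑ c : Composition m, outerTerm γ c (solveCR β γ c.length))
        idOne rfl) (β (n - m - 1)) (by omega)
termination_by n
decreasing_by
  · exact c.2
  · exact lt_of_le_of_lt c.length_le m.isLt

lemma solveCR_spec (β γ : MulSeries K B) : IsCR β γ (solveCR β γ) := by
  intro n b
  rw [outerSum_split]
  conv_rhs => rw [solveCR]
  simp only [sub_apply, sum_apply, outerTerm_apply, concat_apply,
    idOne_apply]
  have h : ∀ m : Fin n, outerSum γ (solveCR β γ) m (fun i => b (i.castLE m.isLt.le)) *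
        (b m * β (n - m - 1) (fun i => b ⟨m + 1 + i, by omega⟩)) =
      (∑ c : Composition m, solveCR β γ c.length (fun j => bracket γ (c.blocksFun j)
        ((fun i : Fin m => b (i.castLE m.isLt.le)) ∘ c.embedding j))) * b m *
        β (n - m - 1) (fun i => b ⟨m + 1 + i, by omega⟩) := by
    intro m
    rw [mul_assoc]
    rfl
  simp only [h]
  rw [add_assoc, sub_sub]
  exact (sub_add_cancel _ _).symm

theorem existsUnique_isCR (β γ : MulSeries K B) : ∃! R : MulSeries K B, IsCR β γ R :=
  ⟨solveCR β γ, solveCR_spec β γ, fun _ h => h.unique (solveCR_spec β γ)⟩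

/-- The series `ᶜR_{β,γ}`: the multilinear function series defined by the recurrence relation
`IsCR β γ`. -/
noncomputable def cRSeries (β γ : MulSeries K B) : MulSeries K B :=
  (existsUnique_isCR β γ).choose

theorem cRSeries_spec (β γ : MulSeries K B) : IsCR β γ (cRSeries β γ) :=
  (existsUnique_isCR β γ).choose_spec.1

end Series

/-! ## Conditional expectations, moment series and conditional freeness -/

section Freeness

variable {K : Type*} [Field K] {A : Type*} [NonUnitalRing A] [Module K A]
  [IsScalarTower K A A] [SMulCommClass K A A]

/-- `E` is a conditional expectation of `A` onto the subalgebra `B`: a linear `B`-bimodule map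
which is the identity on `B`. -/
structure IsCondExp (B : NonUnitalSubalgebra K A) (E : A →ₗ[K] B) : Prop where
  apply_coe : ∀ b : B, E (b : A) = b
  left_mul : ∀ (b : B) (a : A), E ((b : A) * a) = b * E a
  right_mul : ∀ (a : A) (b : B), E (a * (b : A)) = E a * b

/-- The word `X b₁ X b₂ X ⋯ b_n X`. -/
def word {B : NonUnitalSubalgebra K A} (X : A) : (n : ℕ) → (Fin n → B) → A
  | 0, _ => X
  | n + 1, b => X * (b 0 : A) * word X n (Fin.tail b)

lemma word_update_add {B : NonUnitalSubalgebra K A} (X : A) (n : ℕ) (b : Fin n → B) (i : Fin n)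
    (x y : B) : word X n (Function.update b i (x + y)) =
      word X n (Function.update b i x) + word X n (Function.update b i y) := by
  induction n with
  | zero => exact i.elim0
  | succ n ih =>
    cases i using Fin.cases with
    | zero => simp [word, mul_add, add_mul]
    | succ i => simp [word, Fin.tail_update_succ, Function.update_of_ne (Fin.succ_ne_zero i).symm, ih, mul_add]

lemma word_update_smul {B : NonUnitalSubalgebra K A} (X : A) (n : ℕ) (b : Fin n → B) (i : Fin n)
    (t : K) (x : B) : word X n (Function.update b i (t • x)) =
      t • word X n (Function.update b i x) := by
  induction n with
  | zero => exact i.elim0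
  | succ n ih =>
    cases i using Fin.cases with
    | zero => simp [word, mul_smul_comm, smul_mul_assoc]
    | succ i => simp [word, Fin.tail_update_succ, Function.update_of_ne (Fin.succ_ne_zero i).symm, ih, mul_smul_comm]

/-- The moment-generating multilinear function series of `X` with respect to `E`:
`(b₁, …, b_n) ↦ E (X b₁ X b₂ X ⋯ b_n X)`, with constant term `E X`. -/
def momentSeries {B : NonUnitalSubalgebra K A} (E : A →ₗ[K] B) (X : A) : MulSeries K B := fun n =>
  { toFun := fun b => E (word X n b)
    map_update_add' := by
      intro inst b i x y
      rw [Subsingleton.elim inst (instDecidableEqFin n), word_update_add, map_add]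
    map_update_smul' := by
      intro inst b i t x
      rw [Subsingleton.elim inst (instDecidableEqFin n), word_update_smul, map_smul] }

/-- The conditionally free `R`-transform of `X` with respect to the pair `(Φ, Ψ)`: the elements of
the outer block are read through `Φ`-moments (after the block) and `Ψ`-moments (in its gaps). -/
noncomputable def cRTransform {B : NonUnitalSubalgebra K A} (Φ Ψ : A →ₗ[K] B) (X : A) :
    MulSeries K B :=
  cRSeries (momentSeries Φ X) (momentSeries Ψ X)

/-- The product `a₁ a₂ ⋯ a_n` of a non-empty list (`A` need not have a unit). -/
def prodNE {M : Type*} [Mul M] : M → List M → M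
  | a, [] => a
  | a, b :: l => a * prodNE b l

/-- `(i₁, a₁), …, (i_n, a_n)` is a centered alternating word in the subalgebras `S i`: consecutive
indices differ, `a_j ∈ S i_j` and `Ψ a_j = 0`. -/
def IsCenteredAlternating {B : NonUnitalSubalgebra K A} (Ψ : A →ₗ[K] B) {ι : Type*}
    (S : ι → NonUnitalSubalgebra K A) (w : List (ι × A)) : Prop :=
  w.IsChain (fun p q => p.1 ≠ q.1) ∧ ∀ p ∈ w, p.2 ∈ S p.1 ∧ Ψ p.2 = 0

/-- The subalgebras `S i` are free (with amalgamation over `B`) with respect to `Ψ`. -/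
def FreeSubalgebras {B : NonUnitalSubalgebra K A} (Ψ : A →ₗ[K] B) {ι : Type*}
    (S : ι → NonUnitalSubalgebra K A) : Prop :=
  ∀ (p : ι × A) (w : List (ι × A)), IsCenteredAlternating Ψ S (p :: w) →
    Ψ (prodNE p.2 (w.map fun q => q.2)) = 0

/-- The subalgebras `S i` are c-free with respect to `(Φ, Ψ)`: they are free with respect to `Ψ`,
and `Φ (a₁ ⋯ a_n) = Φ a₁ ⋯ Φ a_n` on words which are alternating and centered for `Ψ`. -/
structure CFreeSubalgebras {B : NonUnitalSubalgebra K A} (Φ Ψ : A →ₗ[K] B) {ι : Type*}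
    (S : ι → NonUnitalSubalgebra K A) : Prop where
  free : FreeSubalgebras Ψ S
  factor : ∀ (p : ι × A) (w : List (ι × A)), IsCenteredAlternating Ψ S (p :: w) →
    Φ (prodNE p.2 (w.map fun q => q.2)) = prodNE (Φ p.2) (w.map fun q => Φ q.2)

/-- The elements `X i` are c-free with respect to `(Φ, Ψ)`: the subalgebras generated by `B` and
`X i` are c-free. -/
def CFree {B : NonUnitalSubalgebra K A} (Φ Ψ : A →ₗ[K] B) {ι : Type*} (X : ι → A) : Prop :=
  CFreeSubalgebras Φ Ψ fun i => NonUnitalAlgebra.adjoin K ((B : Set A) ∪ {X i})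

end Freeness

end CFreeProb

/-!
The theorem is proved by expanding `Φ ((X + Y) b₁ (X + Y) ⋯ b_n (X + Y))` according to its first
letter. For each of the two choices, the term is shown to be the sum over all possible "outer
blocks" made of occurrences of that letter alone. Writing `Z = X + Y`, the identity for `X` is
`Φ (X b₁ Z ⋯ b_n Z) = ∑ R_k(Ψ(gap₁), …, Ψ(gap_k)) Φ(rest)`, with `R` the transform of `X`: the sum
is over all choices of further occurrences `Z` which form a block together with the first letter,
the gaps are the parts of the word between consecutive elements of the block, and the rest is what
comes after the last one. Adding the identity for `Y` gives the recurrence relation for the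
moments of `Z`, with the series `ᶜR_X + ᶜR_Y` in the place of the transform, and the recurrence
determines the transform (`IsCR.unique`).

To handle the sum over blocks without indices, a word is read from left to right. What has been
read is recorded by a pair `(t, u)`, where `t = Ψ(gap₁) ⊗ ⋯ ⊗ Ψ(gap_k)` is in the tensor algebra of
`B` and `u` is the part of the word after the last element of the block. A word becomes a bilinear
functional of `(t, u)` (`GapFunctional`), on which a letter `a` outside the block acts by
`u ↦ u a` and an element of the block acts by `(t, u) ↦ (t ⊗ Ψ u, 1)`. The letter `X` acts by the
sum of both, and `Y` by the first only, so that their sum is the action of `Z`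
(`seqWord_add_mem_reducedSpan`). The lemma `seqFunctional_one_one` identifies the value at `(1, 1)`
of the functional of a word with the right-hand side of the recurrence.

It remains to show that `Φ (X w)` is the value at `(1, 1)` of the functional of `w`, for every word
`w` in `X` and elements of the subalgebra `S k` of `Y`. Words in `X` and `B` satisfy this by the
definition of the transform. Next, the pair of a general word and its functional is a linear
combination of pairs of words `p c₁ p₁ c₂ p₂ ⋯`, with `p` a word in `X` and `B`, and with centered
`c_r` in `S k` and centered `p_r` in the algebra of `X` (`reducedSpan`). This uses that the action
of `S k` is multiplicative, so that `c_r b c_{r+1}` can be merged into one letter if `p_r` is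
replaced by a scalar `b ∈ B`. For such a word both sides factor. On the left, `Φ` is multiplicative
by conditional freeness (`IsReduced.apply_mul_snd`). On the right, a block which continues beyond
`p` has a gap that ends with `c₁ p₁ ⋯ c_r p'`, and `Ψ` vanishes on it by freeness
(`IsReduced.fst_apply`); only the blocks inside `p` remain, and the claim for words in `X` and `B`
applies.

Since neither `A` nor `B` needs to have a unit, this argument is carried out in their
unitizations, where `Φ` and `Ψ` extend to unital maps and conditional freeness persists
(`CFreeSubalgebras.unitization`). The transform of `X` over the unitization of `B` restricts to the
one over `B` (`extends_cRTransform`).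
-/

namespace CFreeProb

/-! ### Compositions and their first block -/

/-- A sum over the compositions of `n + 1`, sorted by the first block. -/
lemma sum_composition_succ {M : Type*} [AddCommMonoid M] (f : List ℕ → M) (n : ℕ) :
    ∑ c : Composition (n + 1), f c.blocks =
      ∑ p ∈ Finset.range (n + 1), ∑ c : Composition (n - p), f ((p + 1) :: c.blocks) := by
  classical
  rw [Finset.sum_sigma']
  symm
  refine Finset.sum_bij
    (fun (x : Σ p : ℕ, Composition (n - p)) hx =>
      (⟨(x.1 + 1) :: x.2.blocks, ?_, ?_⟩ : Composition (n + 1))) ?_ ?_ ?_ ?_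
  · intro i hi
    rcases List.mem_cons.1 hi with h | h
    · omega
    · exact x.2.blocks_pos h
  · have := x.2.blocks_sum
    simp only [Finset.mem_sigma, Finset.mem_range] at hx
    simp only [List.sum_cons, this]
    omega
  · intro x _
    exact Finset.mem_univ _
  · rintro ⟨p, c⟩ _ ⟨q, d⟩ _ h
    simp only [Composition.mk.injEq, List.cons.injEq, add_left_inj] at h
    obtain ⟨rfl, h⟩ := h
    rw [Composition.ext h]
  · intro c _
    obtain ⟨l, hpos, hsum⟩ := c
    cases l with
    | nil => simp at hsum
    | cons q l =>
      have hq : 0 < q := hpos List.mem_cons_self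
      simp only [List.sum_cons] at hsum
      obtain ⟨p, rfl⟩ : ∃ p, q = p + 1 := ⟨q - 1, by omega⟩
      refine ⟨⟨p, ⟨l, fun hi => hpos (List.mem_cons_of_mem _ hi), by omega⟩⟩, ?_, rfl⟩
      simp only [Finset.mem_sigma, Finset.mem_range, Finset.mem_univ, and_true]
      omega
  · intro x _
    rfl

/-! ### The Fock-type space and its operators -/

section Fock

variable {K : Type*} [Field K] {A B : Type*} [Ring A] [Algebra K A] [Ring B] [Algebra K B]

/-- The linear functional on the tensor algebra of `B` whose value at `d₁ ⊗ ⋯ ⊗ d_k` is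
`R_k(d₁, …, d_k)`. -/
noncomputable def tensorFunctional (R : MulSeries K B) : TensorAlgebra K B →ₗ[K] B :=
  (DirectSum.toModule K ℕ B fun n => PiTensorProduct.lift (R n)) ∘ₗ
    (TensorAlgebra.toDirectSum (R := K) (M := B)).toLinearMap

lemma tensorFunctional_ofFn (R : MulSeries K B) {n : ℕ} (d : Fin n → B) :
    tensorFunctional R (List.ofFn fun i => TensorAlgebra.ι K (d i)).prod = R n d := by
  rw [← TensorAlgebra.tprod_apply, tensorFunctional, LinearMap.comp_apply,
    AlgHom.toLinearMap_apply, TensorAlgebra.toDirectSum_tensorPower_tprod]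
  exact (DirectSum.toModule_lof K n _).trans (PiTensorProduct.lift.tprod d)

variable (K A B) in
/-- Bilinear functionals of a pair `(t, u)`, where `t = d₁ ⊗ ⋯ ⊗ d_k` records the gaps of a block
of a word read so far, and `u` is the part of the word read since the last element of the
block. -/
abbrev GapFunctional := TensorAlgebra K B →ₗ[K] A →ₗ[K] B

/-- Reading a letter `a` which does not belong to the block. -/
noncomputable def readLetter (a : A) : GapFunctional K A B →ₗ[K] GapFunctional K A B where
  toFun g := g.compl₂ (LinearMap.mulRight K a)
  map_add' _ _ := rfl
  map_smul' _ _ := rfl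

@[simp] lemma readLetter_apply (a : A) (g : GapFunctional K A B) (t : TensorAlgebra K B) (u : A) :
    readLetter a g t u = g t (u * a) := rfl

/-- Reading a letter as an element of the block: the part `u` read since the last element of the
block becomes the gap `Ψ u`. -/
noncomputable def closeGap (Ψ : A →ₗ[K] B) : GapFunctional K A B →ₗ[K] GapFunctional K A B where
  toFun g := LinearMap.mk₂ K (fun t u => g (t * TensorAlgebra.ι K (Ψ u)) 1)
    (fun _ _ _ => by simp [add_mul]) (fun _ _ _ => by simp)
    (fun _ _ _ => by simp [mul_add]) (fun _ _ _ => by simp)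
  map_add' _ _ := rfl
  map_smul' _ _ := rfl

/-- Reading the letter `x`, which may belong to the block or not. -/
noncomputable def readOrClose (Ψ : A →ₗ[K] B) (x : A) :
    GapFunctional K A B →ₗ[K] GapFunctional K A B :=
  readLetter x + closeGap Ψ

@[simp] lemma readOrClose_apply (Ψ : A →ₗ[K] B) (x : A) (g : GapFunctional K A B)
    (t : TensorAlgebra K B) (u : A) :
    readOrClose Ψ x g t u = g t (u * x) + g (t * TensorAlgebra.ι K (Ψ u)) 1 := rfl

/-- The functional of the empty word: the block is complete, with cumulant `R_k(d₁, …, d_k)`, and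
what has been read since its last element contributes its moment. -/
noncomputable def emptyFunctional (R : MulSeries K B) (Φ : A →ₗ[K] B) : GapFunctional K A B :=
  (LinearMap.mul K B ∘ₗ tensorFunctional R).compl₂ Φ

@[simp] lemma emptyFunctional_apply (R : MulSeries K B) (Φ : A →ₗ[K] B) (t : TensorAlgebra K B)
    (u : A) : emptyFunctional R Φ t u = tensorFunctional R t * Φ u := rfl

/-! ### Words with coefficients in `B` -/

/-- The sequence `b` without its first `p` terms. -/
def dropSeq {β : Type*} (p : ℕ) (b : ℕ → β) : ℕ → β := fun i => b (p + i)

lemma dropSeq_dropSeq {β : Type*} (p q : ℕ) (b : ℕ → β) :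
    dropSeq p (dropSeq q b) = dropSeq (q + p) b := by
  funext i
  simp [dropSeq, add_assoc]

@[simp] lemma dropSeq_zero {β : Type*} (b : ℕ → β) : dropSeq 0 b = b := by
  funext i
  simp [dropSeq]

variable (j : B →ₐ[K] A)

/-- The word `b₀ x b₁ x ⋯ b_{n-1} x`. -/
def seqWord (x : A) : ℕ → (ℕ → B) → A
  | 0, _ => 1
  | n + 1, b => j (b 0) * (x * seqWord x n (dropSeq 1 b))

/-- The functional of the word `b₀ x b₁ x ⋯ b_{n-1} x`, in which every `x` may belong to the
block. -/
noncomputable def seqFunctional (R : MulSeries K B) (Φ Ψ : A →ₗ[K] B) (x : A) :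
    ℕ → (ℕ → B) → GapFunctional K A B
  | 0, _ => emptyFunctional R Φ
  | n + 1, b => readLetter (j (b 0)) (readOrClose Ψ x (seqFunctional R Φ Ψ x n (dropSeq 1 b)))

/-- Sorting the terms of `seqFunctional` by the first gap. -/
lemma seqFunctional_eq_firstGap (R : MulSeries K B) (Φ Ψ : A →ₗ[K] B) (x : A) (n : ℕ) (b : ℕ → B)
    (t : TensorAlgebra K B) (u : A) :
    seqFunctional j R Φ Ψ x n b t u = tensorFunctional R t * Φ (u * seqWord j x n b) +
      ∑ p ∈ Finset.range n, seqFunctional j R Φ Ψ x (n - 1 - p) (dropSeq (p + 1) b)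
        (t * TensorAlgebra.ι K (Ψ (u * (seqWord j x p b * j (b p))))) 1 := by
  induction n generalizing b u with
  | zero => simp [seqFunctional, seqWord]
  | succ n ih =>
    rw [Finset.sum_range_succ']
    simp only [seqFunctional, readLetter_apply, readOrClose_apply]
    rw [ih, ← add_assoc]
    congr 1
    · congr 1
      · simp [seqWord, mul_assoc]
      · refine Finset.sum_congr rfl fun p _ => ?_
        rw [dropSeq_dropSeq, show n + 1 - 1 - (p + 1) = n - 1 - p by omega,
          show 1 + (p + 1) = p + 1 + 1 by omega]
        simp [seqWord, mul_assoc, dropSeq, add_comm]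
    · simp [seqWord]

/-- The gaps cut out of the word `b₀ x b₁ x ⋯` by blocks of the given sizes, where a block of
size `p` gives `Ψ(b_s x b_{s+1} x ⋯ b_{s+p-1})`. -/
def gapList (Ψ : A →ₗ[K] B) (x : A) : List ℕ → (ℕ → B) → List B
  | [], _ => []
  | p :: l, b => Ψ (seqWord j x (p - 1) b * j (b (p - 1))) :: gapList Ψ x l (dropSeq p b)

/-- The sum over the compositions of `n` of `R_k` evaluated at the gaps, after the gaps in `t`. -/
noncomputable def gapSum (R : MulSeries K B) (Ψ : A →ₗ[K] B) (x : A) (n : ℕ) (b : ℕ → B)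
    (t : TensorAlgebra K B) : B :=
  ∑ c : Composition n,
    tensorFunctional R (t * ((gapList j Ψ x c.blocks b).map (TensorAlgebra.ι K)).prod)

lemma gapSum_zero (R : MulSeries K B) (Ψ : A →ₗ[K] B) (x : A) (b : ℕ → B)
    (t : TensorAlgebra K B) : gapSum j R Ψ x 0 b t = tensorFunctional R t := by
  have h : ∀ c : Composition 0, c.blocks = [] := fun c => c.blocks_eq_nil.2 rfl
  simp [gapSum, h, gapList, composition_card]

lemma gapSum_succ (R : MulSeries K B) (Ψ : A →ₗ[K] B) (x : A) (n : ℕ) (b : ℕ → B)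
    (t : TensorAlgebra K B) : gapSum j R Ψ x (n + 1) b t =
      ∑ p ∈ Finset.range (n + 1), gapSum j R Ψ x (n - p) (dropSeq (p + 1) b)
        (t * TensorAlgebra.ι K (Ψ (seqWord j x p b * j (b p)))) := by
  unfold gapSum
  rw [sum_composition_succ (fun l => tensorFunctional R
    (t * ((gapList j Ψ x l b).map (TensorAlgebra.ι K)).prod))]
  simp [gapList, mul_assoc]

/-- Sorting the terms of `seqFunctional` by the last element of the block. -/
lemma seqFunctional_eq_sum_gapSum (R : MulSeries K B) (Φ Ψ : A →ₗ[K] B) (x : A) (n : ℕ)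
    (b : ℕ → B) (t : TensorAlgebra K B) :
    seqFunctional j R Φ Ψ x n b t 1 = ∑ m ∈ Finset.range (n + 1),
      gapSum j R Ψ x m b t * Φ (seqWord j x (n - m) (dropSeq m b)) := by
  induction n using Nat.strong_induction_on generalizing b t with
  | _ n ih =>
    rw [seqFunctional_eq_firstGap, Finset.sum_range_succ', add_comm]
    congr 1
    · simp only [gapSum_succ, Finset.sum_mul]
      have h1 : ∀ p ∈ Finset.range n,
          seqFunctional j R Φ Ψ x (n - 1 - p) (dropSeq (p + 1) b)
            (t * TensorAlgebra.ι K (Ψ (1 * (seqWord j x p b * j (b p))))) 1 =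
          ∑ m ∈ Finset.range (n - p), gapSum j R Ψ x m (dropSeq (p + 1) b)
            (t * TensorAlgebra.ι K (Ψ (seqWord j x p b * j (b p)))) *
            Φ (seqWord j x (n - (p + m + 1)) (dropSeq (p + m + 1) b)) := by
        intro p hp
        rw [Finset.mem_range] at hp
        rw [ih _ (by omega), one_mul, show n - 1 - p + 1 = n - p by omega]
        refine Finset.sum_congr rfl fun m _ => ?_
        rw [dropSeq_dropSeq, show n - 1 - p - m = n - (p + m + 1) by omega,
          show p + 1 + m = p + m + 1 by omega]
      rw [Finset.sum_congr rfl h1]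
      rw [Finset.sum_sigma', Finset.sum_sigma']
      refine Finset.sum_nbij' (fun y => ⟨y.1 + y.2, y.1⟩) (fun y => ⟨y.2, y.1 - y.2⟩)
        ?_ ?_ ?_ ?_ ?_
      · rintro ⟨p, m⟩ h
        simp only [Finset.mem_sigma, Finset.mem_range] at h ⊢
        omega
      · rintro ⟨p, m⟩ h
        simp only [Finset.mem_sigma, Finset.mem_range] at h ⊢
        omega
      · rintro ⟨p, m⟩ h
        simp
      · rintro ⟨p, m⟩ h
        simp only [Finset.mem_sigma, Finset.mem_range] at h
        simp only [Sigma.mk.injEq, heq_eq_eq, and_true]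
        omega
      · rintro ⟨p, m⟩ h
        simp only [add_tsub_cancel_left]
    · simp [gapSum_zero]

/-! ### Comparison with the recurrence relation -/

/-- The moment series `(b₁, …, b_n) ↦ E(x b₁ x ⋯ b_n x)`, for a ring `B` mapped to `A` by `j`. -/
noncomputable def unitalMomentSeries (E : A →ₗ[K] B) (x : A) : MulSeries K B := fun n =>
  (E ∘ₗ LinearMap.mulLeft K x).compMultilinearMap
    ((MultilinearMap.mkPiAlgebraFin K n A).compLinearMap
      fun _ => LinearMap.mulRight K x ∘ₗ j.toLinearMap)

lemma unitalMomentSeries_apply (E : A →ₗ[K] B) (x : A) (n : ℕ) (b : Fin n → B) :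
    unitalMomentSeries j E x n b = E (x * (List.ofFn fun i => j (b i) * x).prod) := by
  simp [unitalMomentSeries]

lemma seqWord_eq_prod (x : A) (n : ℕ) (b : ℕ → B) :
    seqWord j x n b = (List.ofFn fun i : Fin n => j (b i) * x).prod := by
  induction n generalizing b with
  | zero => rfl
  | succ n ih =>
    simp [seqWord, ih, List.ofFn_succ, mul_assoc, dropSeq, add_comm]

lemma unitalMomentSeries_seq (E : A →ₗ[K] B) (x : A) (n : ℕ) (b : ℕ → B) :
    unitalMomentSeries j E x n (fun i => b i) = E (x * seqWord j x n b) := by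
  rw [unitalMomentSeries_apply, seqWord_eq_prod]

/-- `Φ` is a unital bimodule map for the two-sided action of `B` on `A` through `j`. -/
structure IsUnitalCondExp (Φ : A →ₗ[K] B) : Prop where
  map_one : Φ 1 = 1
  left_mul : ∀ (b : B) (a : A), Φ (j b * a) = b * Φ a
  right_mul : ∀ (a : A) (b : B), Φ (a * j b) = Φ a * b

variable {j}

lemma IsUnitalCondExp.apply_coe {Φ : A →ₗ[K] B} (h : IsUnitalCondExp j Φ) (b : B) :
    Φ (j b) = b := by
  simpa [h.map_one] using h.left_mul b 1

lemma bracket_unitalMomentSeries {Ψ : A →ₗ[K] B} (h : IsUnitalCondExp j Ψ) (x : A) (p : ℕ)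
    (hp : 1 ≤ p) (b : ℕ → B) :
    bracket (unitalMomentSeries j Ψ x) p (fun i => b i) =
      Ψ (seqWord j x (p - 1) b * j (b (p - 1))) := by
  match p with
  | 1 => simp [bracket, seqWord, h.apply_coe]
  | p + 2 =>
    have := unitalMomentSeries_seq j Ψ x p (dropSeq 1 b)
    simp only [dropSeq] at this
    have hr : (fun i : Fin p => b i.succ.castSucc) = fun i : Fin p => b (1 + i) := by
      funext i
      simp [add_comm]
    simp only [bracket, hr, this, Nat.add_one_sub_one, seqWord, mul_assoc, h.left_mul]
    rw [← mul_assoc x, h.right_mul]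
    rfl

lemma gapList_length (Ψ : A →ₗ[K] B) (x : A) (l : List ℕ) (b : ℕ → B) :
    (gapList j Ψ x l b).length = l.length := by
  induction l generalizing b with
  | nil => rfl
  | cons p l ih => simp [gapList, ih]

lemma gapList_getElem (Ψ : A →ₗ[K] B) (x : A) (l : List ℕ) (b : ℕ → B) (i : ℕ)
    (hi : i < (gapList j Ψ x l b).length) :
    (gapList j Ψ x l b)[i] = Ψ (seqWord j x (l[i]'(by simpa [gapList_length] using hi) - 1)
      (dropSeq (l.take i).sum b) *
        j (b ((l.take i).sum + (l[i]'(by simpa [gapList_length] using hi) - 1)))) := by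
  induction l generalizing b i with
  | nil => simp [gapList] at hi
  | cons p l ih =>
    cases i with
    | zero => simp [gapList]
    | succ i =>
      simp only [gapList, List.getElem_cons_succ, ih, dropSeq_dropSeq, List.take_succ_cons,
        List.sum_cons]
      simp [dropSeq, add_assoc]

lemma outerSum_unitalMomentSeries {Ψ : A →ₗ[K] B} (h : IsUnitalCondExp j Ψ) (R : MulSeries K B)
    (x : A) (m : ℕ) (b : ℕ → B) :
    outerSum (unitalMomentSeries j Ψ x) R m (fun i => b i) = gapSum j R Ψ x m b 1 := by
  unfold outerSum gapSum
  refine Finset.sum_congr rfl fun c _ => ?_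
  rw [one_mul, ← tensorFunctional_ofFn]
  congr 2
  refine List.ext_getElem (by simp [gapList_length]) fun i h1 h2 => ?_
  have hi : i < c.length := by simpa using h1
  simp only [List.getElem_ofFn, List.getElem_map, gapList_getElem]
  congr 1
  have := bracket_unitalMomentSeries h x (c.blocksFun ⟨i, hi⟩) (c.one_le_blocksFun _)
    (dropSeq (c.sizeUpTo i) b)
  exact this

lemma outerSum_add_right (γ R S : MulSeries K B) (m : ℕ) (b : Fin m → B) :
    outerSum γ (R + S) m b = outerSum γ R m b + outerSum γ S m b := by
  simp [outerSum, Finset.sum_add_distrib]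

/-- The right-hand side of the recurrence relation, for moment series, is the value of
`seqFunctional` at the empty block and the empty gap. -/
lemma seqFunctional_one_one {Φ Ψ : A →ₗ[K] B} (hΦ : IsUnitalCondExp j Φ)
    (hΨ : IsUnitalCondExp j Ψ) (R : MulSeries K B) (x : A) (n : ℕ) (b : ℕ → B) :
    seqFunctional j R Φ Ψ x n b 1 1 =
      outerSum (unitalMomentSeries j Ψ x) R n (fun i => b i) +
      ∑ m : Fin n, outerSum (unitalMomentSeries j Ψ x) R m (fun i => b i) *
        (b m * unitalMomentSeries j Φ x (n - m - 1) (fun i => b (m + 1 + i))) := by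
  rw [seqFunctional_eq_sum_gapSum, Finset.sum_range_succ, add_comm, ← Fin.sum_univ_eq_sum_range
    (fun m => gapSum j R Ψ x m b 1 * Φ (seqWord j x (n - m) (dropSeq m b)))]
  congr 1
  · simp [outerSum_unitalMomentSeries hΨ, seqWord, hΦ.map_one]
  · refine Finset.sum_congr rfl fun m _ => ?_
    rw [outerSum_unitalMomentSeries hΨ]
    congr 1
    obtain ⟨k, hk⟩ : ∃ k, n - m = k + 1 := ⟨n - m - 1, by omega⟩
    have := unitalMomentSeries_seq j Φ x k (dropSeq (m + 1) b)
    rw [hk, seqWord, hΦ.left_mul, dropSeq_dropSeq, ← this]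
    rfl

lemma isCR_unitalMomentSeries_iff {Φ Ψ : A →ₗ[K] B} (hΦ : IsUnitalCondExp j Φ)
    (hΨ : IsUnitalCondExp j Ψ) (R : MulSeries K B) (x : A) :
    IsCR (unitalMomentSeries j Φ x) (unitalMomentSeries j Ψ x) R ↔
      ∀ (n : ℕ) (b : ℕ → B), Φ (x * seqWord j x n b) = seqFunctional j R Φ Ψ x n b 1 1 := by
  constructor
  · intro h n b
    rw [seqFunctional_one_one hΦ hΨ, ← unitalMomentSeries_seq]
    exact h n _
  · intro h n b
    -- a tuple is extended by `0` to a sequence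
    obtain ⟨b, rfl⟩ : ∃ b' : ℕ → B, b = fun i : Fin n => b' i :=
      ⟨fun i => if hi : i < n then b ⟨i, hi⟩ else 0, by funext i; simp⟩
    have := h n b
    rw [seqFunctional_one_one hΦ hΨ, ← unitalMomentSeries_seq] at this
    exact this

end Fock

section UnitalFreeness

variable {K : Type*} [Field K] {A B : Type*} [Ring A] [Algebra K A] [Ring B] [Algebra K B]

/-! ### Centered alternating words in unital algebras -/

/-- Conditional freeness of unital subalgebras which contain the image of `B`. -/
structure UnitalCFree (j : B →ₐ[K] A) (Φ Ψ : A →ₗ[K] B) {ι : Type*} (S : ι → Subalgebra K A) :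
    Prop where
  coe_mem : ∀ i b, j b ∈ S i
  free : ∀ w : List (ι × A), w ≠ [] → w.IsChain (fun p q => p.1 ≠ q.1) →
    (∀ p ∈ w, p.2 ∈ S p.1 ∧ Ψ p.2 = 0) → Ψ (w.map Prod.snd).prod = 0
  factor : ∀ w : List (ι × A), w ≠ [] → w.IsChain (fun p q => p.1 ≠ q.1) →
    (∀ p ∈ w, p.2 ∈ S p.1 ∧ Ψ p.2 = 0) →
      Φ (w.map Prod.snd).prod = (w.map fun p => Φ p.2).prod

/-- The products of centered alternating words whose last factor lies in `S i`. -/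
def alternatingEnd (Ψ : A →ₗ[K] B) {ι : Type*} (S : ι → Subalgebra K A) (i : ι) : Set A :=
  {x | ∃ (w : List (ι × A)) (a : A), (w ++ [(i, a)]).IsChain (fun p q => p.1 ≠ q.1) ∧
    (∀ p ∈ w ++ [(i, a)], p.2 ∈ S p.1 ∧ Ψ p.2 = 0) ∧ ((w ++ [(i, a)]).map Prod.snd).prod = x}

/-- The products of centered alternating words whose first factor lies in `S i`. -/
def alternatingStart (Ψ : A →ₗ[K] B) {ι : Type*} (S : ι → Subalgebra K A) (i : ι) : Set A :=
  {x | ∃ (a : A) (w : List (ι × A)), ((i, a) :: w).IsChain (fun p q => p.1 ≠ q.1) ∧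
    (∀ p ∈ (i, a) :: w, p.2 ∈ S p.1 ∧ Ψ p.2 = 0) ∧ (((i, a) :: w).map Prod.snd).prod = x}

variable {j : B →ₐ[K] A} {Φ Ψ : A →ₗ[K] B} {ι : Type*} {S : ι → Subalgebra K A} {i k : ι}

lemma mem_alternatingEnd {a : A} (ha : a ∈ S i) (ha0 : Ψ a = 0) : a ∈ alternatingEnd Ψ S i :=
  ⟨[], a, by simp, by simp [ha, ha0], by simp⟩

lemma mem_alternatingStart {a : A} (ha : a ∈ S i) (ha0 : Ψ a = 0) :
    a ∈ alternatingStart Ψ S i :=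
  ⟨a, [], by simp, by simp [ha, ha0], by simp⟩

lemma mul_mem_alternatingEnd (hik : i ≠ k) {x a : A} (hx : x ∈ alternatingEnd Ψ S i)
    (ha : a ∈ S k) (ha0 : Ψ a = 0) : x * a ∈ alternatingEnd Ψ S k := by
  obtain ⟨w, y, hc, hm, rfl⟩ := hx
  refine ⟨w ++ [(i, y)], a, ?_, ?_, by simp [mul_assoc]⟩
  · rw [List.isChain_append]
    exact ⟨hc, by simp, by simpa using hik⟩
  · intro p hp
    rcases List.mem_append.1 hp with hp | hp
    · exact hm p hp
    · obtain rfl : p = (k, a) := by simpa using hp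
      exact ⟨ha, ha0⟩

lemma mul_mem_alternatingStart (hik : i ≠ k) {x a : A} (hx : x ∈ alternatingStart Ψ S i)
    (ha : a ∈ S k) (ha0 : Ψ a = 0) : a * x ∈ alternatingStart Ψ S k := by
  obtain ⟨y, w, hc, hm, rfl⟩ := hx
  refine ⟨a, (i, y) :: w, ?_, ?_, by simp⟩
  · rw [List.isChain_cons_cons]
    exact ⟨hik.symm, hc⟩
  · intro p hp
    rcases List.mem_cons.1 hp with rfl | hp
    · exact ⟨ha, ha0⟩
    · exact hm p hp

lemma sub_coe_mem (h : UnitalCFree j Φ Ψ S) {a : A} (ha : a ∈ S i) : a - j (Ψ a) ∈ S i :=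
  (S i).sub_mem ha (h.coe_mem i _)

lemma IsUnitalCondExp.apply_sub_coe (hΨ : IsUnitalCondExp j Ψ) (a : A) :
    Ψ (a - j (Ψ a)) = 0 := by
  simp [hΨ.apply_coe]

lemma apply_alternatingEnd (h : UnitalCFree j Φ Ψ S) {x : A}
    (hx : x ∈ Submodule.span K (alternatingEnd Ψ S i)) : Ψ x = 0 := by
  induction hx using Submodule.span_induction with
  | mem x hx =>
    obtain ⟨w, y, hc, hm, rfl⟩ := hx
    exact h.free _ (by simp) hc hm
  | zero => simp
  | add x y _ _ hx hy => simp [hx, hy]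
  | smul t x _ hx => simp [hx]

/-- If `x` ends with a centered factor in `S k`, then `Ψ (x a) = 0` for all `a` in `S i`. -/
lemma apply_alternatingEnd_mul (h : UnitalCFree j Φ Ψ S) (hΨ : IsUnitalCondExp j Ψ) (hik : i ≠ k)
    {x a : A} (hx : x ∈ Submodule.span K (alternatingEnd Ψ S k)) (ha : a ∈ S i) :
    Ψ (x * a) = 0 := by
  have h1 : x * (a - j (Ψ a)) ∈ Submodule.span K (alternatingEnd Ψ S i) := by
    have := Submodule.span_image (R := K) (LinearMap.mulRight K (a - j (Ψ a)))
      (s := alternatingEnd Ψ S k)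
    refine Submodule.span_mono ?_ (this ▸ Submodule.mem_map_of_mem hx)
    rintro _ ⟨y, hy, rfl⟩
    exact mul_mem_alternatingEnd hik.symm hy (sub_coe_mem h ha) (hΨ.apply_sub_coe a)
  have h2 := apply_alternatingEnd h h1
  rwa [mul_sub, map_sub, hΨ.right_mul, apply_alternatingEnd h hx, zero_mul, sub_zero] at h2

lemma apply_mul_alternatingStart (h : UnitalCFree j Φ Ψ S) (hΨ : IsUnitalCondExp j Ψ)
    (hΦ : IsUnitalCondExp j Φ) (hik : i ≠ k) {x a : A} (hx : x ∈ alternatingStart Ψ S k)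
    (ha : a ∈ S i) : Φ (a * x) = Φ a * Φ x := by
  obtain ⟨y, w, hc, hm, rfl⟩ := hx
  have hcen : Φ ((a - j (Ψ a)) * (((k, y) :: w).map Prod.snd).prod) =
      Φ (a - j (Ψ a)) * Φ (((k, y) :: w).map Prod.snd).prod := by
    have h1 := h.factor ((i, a - j (Ψ a)) :: (k, y) :: w) (by simp)
      (List.isChain_cons_cons.2 ⟨hik, hc⟩) (by
        intro p hp
        rcases List.mem_cons.1 hp with rfl | hp
        · exact ⟨sub_coe_mem h ha, hΨ.apply_sub_coe a⟩
        · exact hm p hp)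
    rw [h.factor _ (by simp) hc hm]
    simpa using h1
  rw [sub_mul, map_sub, map_sub, hΦ.left_mul, hΦ.apply_coe, sub_mul] at hcen
  exact sub_left_inj.1 hcen

/-- The span of `B` and of the products of centered alternating words whose last factor lies
in `S i`. -/
def alternatingSpan (j : B →ₐ[K] A) (Ψ : A →ₗ[K] B) (S : ι → Subalgebra K A) (i : ι) :
    Submodule K A :=
  Submodule.span K (alternatingEnd Ψ S i ∪ Set.range j)

lemma mem_alternatingSpan (h : UnitalCFree j Φ Ψ S) (hΨ : IsUnitalCondExp j Ψ) {a : A}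
    (ha : a ∈ S i) : a ∈ alternatingSpan j Ψ S i := by
  rw [← sub_add_cancel a (j (Ψ a))]
  exact add_mem (Submodule.subset_span
    (Or.inl (mem_alternatingEnd (sub_coe_mem h ha) (hΨ.apply_sub_coe a))))
    (Submodule.subset_span (Or.inr ⟨_, rfl⟩))

lemma mul_mem_span_alternatingEnd (h : UnitalCFree j Φ Ψ S) (hΨ : IsUnitalCondExp j Ψ)
    (hik : i ≠ k) {u c : A} (hu : u ∈ alternatingSpan j Ψ S i) (hc : c ∈ S k) (hc0 : Ψ c = 0) :
    u * c ∈ Submodule.span K (alternatingEnd Ψ S k) := by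
  induction hu using Submodule.span_induction with
  | mem x hx =>
    refine Submodule.subset_span ?_
    rcases hx with hx | ⟨b, rfl⟩
    · exact mul_mem_alternatingEnd hik hx hc hc0
    · exact mem_alternatingEnd ((S k).mul_mem (h.coe_mem k b) hc) (by simp [hΨ.left_mul, hc0])
  | zero => simp
  | add x y _ _ hx hy => rw [add_mul]; exact add_mem hx hy
  | smul t x _ hx => rw [smul_mul_assoc]; exact Submodule.smul_mem _ _ hx

lemma mul_mem_alternatingSpan (hik : i ≠ k) {v p : A}
    (hv : v ∈ Submodule.span K (alternatingEnd Ψ S k)) (hp : p ∈ S i) (hp0 : Ψ p = 0) :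
    v * p ∈ alternatingSpan j Ψ S i := by
  induction hv using Submodule.span_induction with
  | mem x hx => exact Submodule.subset_span (Or.inl (mul_mem_alternatingEnd hik.symm hx hp hp0))
  | zero => simp
  | add x y _ _ hx hy => rw [add_mul]; exact add_mem hx hy
  | smul t x _ hx => rw [smul_mul_assoc]; exact Submodule.smul_mem _ _ hx

/-! ### Words paired with their functionals -/

/-- Left multiplication of a word by a letter `a` outside the block, on pairs formed by the
functional and the value of a word. -/
noncomputable def consLetter (a : A) : (GapFunctional K A B × A) →ₗ[K] (GapFunctional K A B × A) :=
  (readLetter a).prodMap (LinearMap.mulLeft K a)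

/-- Left multiplication of a word by a letter `x` which may belong to the block, on pairs formed
by the functional and the value of a word. -/
noncomputable def consBlock (Ψ : A →ₗ[K] B) (x : A) :
    (GapFunctional K A B × A) →ₗ[K] (GapFunctional K A B × A) :=
  (readOrClose Ψ x).prodMap (LinearMap.mulLeft K x)

lemma consLetter_add (a a' : A) (m : GapFunctional K A B × A) :
    consLetter (a + a') m = consLetter a m + consLetter a' m := by
  refine Prod.ext ?_ (add_mul _ _ _)
  ext t u
  simp [consLetter, mul_add]

lemma consLetter_consLetter (a a' : A) (m : GapFunctional K A B × A) :
    consLetter a (consLetter a' m) = consLetter (a * a') m := by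
  refine Prod.ext ?_ (mul_assoc _ _ _).symm
  ext t u
  simp [consLetter, mul_assoc]

lemma consLetter_one (m : GapFunctional K A B × A) : consLetter (1 : A) m = m := by
  refine Prod.ext ?_ (one_mul _)
  ext t u
  simp [consLetter]

/-- Left multiplication by the word `b₁ x b₂ x ⋯ b_n x b`, each `x` of which may belong to the
block, on pairs formed by the functional and the value of a word. -/
noncomputable def consWord (j : B →ₐ[K] A) (Ψ : A →ₗ[K] B) (x : A) :
    List B → B → (GapFunctional K A B × A) →ₗ[K] (GapFunctional K A B × A)
  | [], b => consLetter (j b)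
  | b' :: l, b => consLetter (j b') ∘ₗ consBlock Ψ x ∘ₗ consWord j Ψ x l b

/-- The element `b₁ x b₂ x ⋯ b_n x b` of `A`. -/
def wordVal (j : B →ₐ[K] A) (x : A) : List B → B → A
  | [], b => j b
  | b' :: l, b => j b' * (x * wordVal j x l b)

/-- Left multiplication by the centered word `p - Ψ p`, where `p = b₁ x b₂ x ⋯ b_n x b`. -/
noncomputable def consCentered (j : B →ₐ[K] A) (Ψ : A →ₗ[K] B) (x : A) (l : List B) (b : B) :
    (GapFunctional K A B × A) →ₗ[K] (GapFunctional K A B × A) :=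
  consWord j Ψ x l b + consLetter (j (-Ψ (wordVal j x l b)))

lemma consWord_snd (x : A) (l : List B) (b : B) (m : GapFunctional K A B × A) :
    (consWord j Ψ x l b m).2 = wordVal j x l b * m.2 := by
  induction l with
  | nil => rfl
  | cons b' l ih =>
    simp [consWord, wordVal, consLetter, consBlock, ih, mul_assoc]

lemma consCentered_snd (x : A) (l : List B) (b : B) (m : GapFunctional K A B × A) :
    (consCentered j Ψ x l b m).2 =
      (wordVal j x l b - j (Ψ (wordVal j x l b))) * m.2 := by
  rw [sub_eq_add_neg, ← map_neg, add_mul, ← consWord_snd (Ψ := Ψ)]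
  rfl

lemma wordVal_mem (h : UnitalCFree j Φ Ψ S) {x : A} (hx : x ∈ S i) (l : List B) (b : B) :
    wordVal j x l b ∈ S i := by
  induction l with
  | nil => exact h.coe_mem i b
  | cons b' l ih => exact (S i).mul_mem (h.coe_mem i b') ((S i).mul_mem hx ih)

/-- The pair attached to the empty word. -/
noncomputable def emptyWord (R : MulSeries K B) (Φ : A →ₗ[K] B) : GapFunctional K A B × A :=
  (emptyFunctional R Φ, 1)

/-- After an argument whose products with `S i` are all centered, no letter `x ∈ S i` can be an
element of the block, since the gap before it would vanish. -/
lemma consWord_fst_of_centered (h : UnitalCFree j Φ Ψ S) {x : A} (hx : x ∈ S i) (l : List B)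
    (b : B) (m : GapFunctional K A B × A) (t : TensorAlgebra K B) (v : A)
    (hv : ∀ a ∈ S i, Ψ (v * a) = 0) :
    (consWord j Ψ x l b m).1 t v = m.1 t (v * wordVal j x l b) := by
  induction l generalizing v with
  | nil => rfl
  | cons b' l ih =>
    have h1 : Ψ (v * j b') = 0 := hv _ (h.coe_mem i b')
    have h2 := ih (v * j b' * x) fun a ha => by
      rw [mul_assoc, mul_assoc]
      exact hv _ ((S i).mul_mem (h.coe_mem i b') ((S i).mul_mem hx ha))
    simp only [consWord, LinearMap.comp_apply, consLetter, consBlock, LinearMap.prodMap_apply,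
      readLetter_apply, readOrClose_apply, h1, map_zero, mul_zero, LinearMap.zero_apply,
      add_zero, h2]
    simp only [wordVal, mul_assoc]

/-- On a pair whose functional only sees the completed block, left multiplication by a word in
`x` acts as on the empty word, up to the factor `φ`. -/
lemma consWord_fst_eq_mul (h : UnitalCFree j Φ Ψ S) {x : A} (hx : x ∈ S i) (R : MulSeries K B)
    (l : List B) (b : B) (m : GapFunctional K A B × A) (φ : B)
    (hm : ∀ t, ∀ u ∈ S i, m.1 t u = tensorFunctional R t * Φ u * φ) (t : TensorAlgebra K B) (u : A)
    (hu : u ∈ S i) :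
    (consWord j Ψ x l b m).1 t u = (consWord j Ψ x l b (emptyWord R Φ)).1 t u * φ := by
  induction l generalizing t u with
  | nil => exact hm t _ ((S i).mul_mem hu (h.coe_mem i b))
  | cons b' l ih =>
    simp only [consWord, LinearMap.comp_apply, consLetter, consBlock, LinearMap.prodMap_apply,
      readLetter_apply, readOrClose_apply, add_mul]
    rw [ih _ _ ((S i).mul_mem ((S i).mul_mem hu (h.coe_mem i b')) hx), ih _ _ (S i).one_mem]

lemma consWord_eq_comp (x : A) (l : List B) (b : B) (m : GapFunctional K A B × A) :
    consWord j Ψ x l b m = consWord j Ψ x l 1 (consLetter (j b) m) := by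
  induction l with
  | nil => simp [consWord, consLetter_one]
  | cons b' l ih => simp [consWord, ih]

lemma dropSeq_getD_cons (b' : B) (l : List B) :
    dropSeq 1 (fun i => (b' :: l).getD i 0) = fun i => l.getD i 0 := by
  funext i
  simp [dropSeq, add_comm 1 i]

lemma wordVal_eq_seqWord (x : A) (l : List B) (b : B) :
    wordVal j x l b = seqWord j x l.length (fun i => l.getD i 0) * j b := by
  induction l with
  | nil => simp [wordVal, seqWord]
  | cons b' l ih =>
    simp only [wordVal, ih, List.length_cons, seqWord, dropSeq_getD_cons, List.getD_cons_zero,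
      mul_assoc]

lemma consWord_one_emptyWord_fst (R : MulSeries K B) (x : A) (l : List B) :
    (consWord j Ψ x l 1 (emptyWord R Φ)).1 =
      seqFunctional j R Φ Ψ x l.length (fun i => l.getD i 0) := by
  induction l with
  | nil => simp [consWord, consLetter_one, emptyWord, seqFunctional]
  | cons b' l ih =>
    simp only [consWord, LinearMap.comp_apply, consLetter, consBlock, LinearMap.prodMap_apply, ih]
    simp only [List.length_cons, seqFunctional, dropSeq_getD_cons, List.getD_cons_zero]

/-- The recurrence relation for the moments of `x`, in terms of words in `x` and `B`. -/
lemma consWord_emptyWord_one_one (h : UnitalCFree j Φ Ψ S) (hΦ : IsUnitalCondExp j Φ)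
    (hΨ : IsUnitalCondExp j Ψ) {x : A} (hx : x ∈ S i) {R : MulSeries K B}
    (hR : IsCR (unitalMomentSeries j Φ x) (unitalMomentSeries j Ψ x) R) (l : List B) (b : B) :
    (consWord j Ψ x l b (emptyWord R Φ)).1 1 1 = Φ (x * wordVal j x l b) := by
  rw [consWord_eq_comp, consWord_fst_eq_mul h hx R l 1 _ b _ _ _ (S i).one_mem,
    consWord_one_emptyWord_fst, ← (isCR_unitalMomentSeries_iff hΦ hΨ R x).1 hR,
    wordVal_eq_seqWord, ← mul_assoc, hΦ.right_mul]
  intro t u _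
  simp [consLetter, emptyWord, hΦ.right_mul, mul_assoc]

/-! ### Reduction to centered alternating words -/

/-- The centered alternating words `c₁ p₁ c₂ p₂ ⋯`, whose first factor, if any, is in `S k`, with
centered `c_r ∈ S k`, and with every `p_r` a centered word in `x` and `B`. -/
inductive IsReduced (j : B →ₐ[K] A) (Φ Ψ : A →ₗ[K] B) (S : ι → Subalgebra K A) (k : ι)
    (R : MulSeries K B) (x : A) : GapFunctional K A B × A → Prop
  | empty : IsReduced j Φ Ψ S k R x (emptyWord R Φ)
  | single (c : A) (hc : c ∈ S k) (hc0 : Ψ c = 0) :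
      IsReduced j Φ Ψ S k R x (consLetter c (emptyWord R Φ))
  | cons (c : A) (hc : c ∈ S k) (hc0 : Ψ c = 0) (l : List B) (b : B)
      (m : GapFunctional K A B × A) (hm : IsReduced j Φ Ψ S k R x m) :
      IsReduced j Φ Ψ S k R x (consLetter c (consCentered j Ψ x l b m))

lemma IsReduced.snd_mem (h : UnitalCFree j Φ Ψ S) (hΨ : IsUnitalCondExp j Ψ) (hik : i ≠ k)
    {R : MulSeries K B} {x : A} (hx : x ∈ S i) {m : GapFunctional K A B × A}
    (hm : IsReduced j Φ Ψ S k R x m) : m.2 = 1 ∨ m.2 ∈ alternatingStart Ψ S k := by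
  induction hm with
  | empty => exact Or.inl rfl
  | single c hc hc0 =>
    right
    simpa [consLetter, emptyWord] using mem_alternatingStart hc hc0
  | cons c hc hc0 l b m _ ih =>
    right
    have hp := sub_coe_mem h (wordVal_mem h hx l b)
    have hp0 := hΨ.apply_sub_coe (wordVal j x l b)
    change c * (consCentered j Ψ x l b m).2 ∈ _
    rw [consCentered_snd]
    refine mul_mem_alternatingStart hik ?_ hc hc0
    rcases ih with ih | ih
    · rw [ih, mul_one]
      exact mem_alternatingStart hp hp0
    · exact mul_mem_alternatingStart hik.symm ih hp hp0

lemma IsReduced.apply_mul_snd (h : UnitalCFree j Φ Ψ S) (hΦ : IsUnitalCondExp j Φ)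
    (hΨ : IsUnitalCondExp j Ψ) (hik : i ≠ k) {R : MulSeries K B} {x : A} (hx : x ∈ S i)
    {m : GapFunctional K A B × A} (hm : IsReduced j Φ Ψ S k R x m) {a : A} (ha : a ∈ S i) :
    Φ (a * m.2) = Φ a * Φ m.2 := by
  rcases hm.snd_mem h hΨ hik hx with h1 | h1
  · simp [h1, hΦ.map_one]
  · exact apply_mul_alternatingStart h hΨ hΦ hik h1 ha

/-- The block cannot be continued in a reduced word: the gap before the next element of the block
would be a centered alternating word. -/
lemma IsReduced.fst_apply (h : UnitalCFree j Φ Ψ S) (hΨ : IsUnitalCondExp j Ψ) (hik : i ≠ k)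
    {R : MulSeries K B} {x : A} (hx : x ∈ S i) {m : GapFunctional K A B × A}
    (hm : IsReduced j Φ Ψ S k R x m) (t : TensorAlgebra K B) (u : A)
    (hu : u ∈ alternatingSpan j Ψ S i) :
    m.1 t u = tensorFunctional R t * Φ (u * m.2) := by
  induction hm generalizing u with
  | empty => simp [emptyWord]
  | single c hc hc0 => simp [consLetter, emptyWord]
  | cons c hc hc0 l b m _ ih =>
    have hv := mul_mem_span_alternatingEnd h hΨ hik hu hc hc0
    have h1 := consWord_fst_of_centered h hx l b m t (u * c)
      fun a ha => apply_alternatingEnd_mul h hΨ hik hv ha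
    have h2 := ih _ (mul_mem_alternatingSpan (j := j) hik hv (sub_coe_mem h (wordVal_mem h hx l b))
      (hΨ.apply_sub_coe (wordVal j x l b)))
    calc (consWord j Ψ x l b m).1 t (u * c) + m.1 t (u * c * j (-Ψ (wordVal j x l b)))
        = m.1 t (u * c * (wordVal j x l b - j (Ψ (wordVal j x l b)))) := by
          rw [h1, ← map_add, ← mul_add, map_neg, sub_eq_add_neg]
      _ = _ := by
          rw [h2]
          change _ = tensorFunctional R t * Φ (u * (c * (consCentered j Ψ x l b m).2))
          rw [consCentered_snd]
          simp only [mul_assoc]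

/-- The span of the words `p w`, with `p` a word in `x` and `B`, and `w` reduced. -/
noncomputable def reducedSpan (j : B →ₐ[K] A) (Φ Ψ : A →ₗ[K] B) (S : ι → Subalgebra K A) (k : ι)
    (R : MulSeries K B) (x : A) : Submodule K (GapFunctional K A B × A) :=
  Submodule.span K {y | ∃ l b m, IsReduced j Φ Ψ S k R x m ∧ consWord j Ψ x l b m = y}

lemma consWord_mem_reducedSpan {R : MulSeries K B} {x : A} (l : List B) (b : B)
    {m : GapFunctional K A B × A} (hm : IsReduced j Φ Ψ S k R x m) :
    consWord j Ψ x l b m ∈ reducedSpan j Φ Ψ S k R x :=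
  Submodule.subset_span ⟨l, b, m, hm, rfl⟩

lemma IsReduced.mem_reducedSpan {R : MulSeries K B} {x : A} {m : GapFunctional K A B × A}
    (hm : IsReduced j Φ Ψ S k R x m) : m ∈ reducedSpan j Φ Ψ S k R x := by
  simpa [consWord, consLetter_one] using consWord_mem_reducedSpan [] 1 hm

lemma map_mem_reducedSpan {R : MulSeries K B} {x : A}
    (f : (GapFunctional K A B × A) →ₗ[K] (GapFunctional K A B × A))
    (hf : ∀ l b m, IsReduced j Φ Ψ S k R x m →
      f (consWord j Ψ x l b m) ∈ reducedSpan j Φ Ψ S k R x)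
    {y : GapFunctional K A B × A} (hy : y ∈ reducedSpan j Φ Ψ S k R x) :
    f y ∈ reducedSpan j Φ Ψ S k R x := by
  have : reducedSpan j Φ Ψ S k R x ≤ (reducedSpan j Φ Ψ S k R x).comap f := by
    refine Submodule.span_le.2 ?_
    rintro _ ⟨l, b, m, hm, rfl⟩
    exact hf l b m hm
  exact this hy

lemma consLetter_coe_mem_reducedSpan {R : MulSeries K B} {x : A} (b : B)
    {y : GapFunctional K A B × A} (hy : y ∈ reducedSpan j Φ Ψ S k R x) :
    consLetter (j b) y ∈ reducedSpan j Φ Ψ S k R x := by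
  refine map_mem_reducedSpan _ (fun l b' m hm => ?_) hy
  cases l with
  | nil =>
    have := consWord_mem_reducedSpan (Ψ := Ψ) [] (b * b') hm
    simpa [consWord, consLetter_consLetter] using this
  | cons b'' l =>
    have := consWord_mem_reducedSpan (Ψ := Ψ) ((b * b'') :: l) b' hm
    simpa [consWord, consLetter_consLetter] using this

lemma consBlock_mem_reducedSpan {R : MulSeries K B} {x : A} {y : GapFunctional K A B × A}
    (hy : y ∈ reducedSpan j Φ Ψ S k R x) :
    consBlock Ψ x y ∈ reducedSpan j Φ Ψ S k R x := by
  refine map_mem_reducedSpan _ (fun l b m hm => ?_) hy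
  have := consWord_mem_reducedSpan (Ψ := Ψ) (1 :: l) b hm
  simpa [consWord, consLetter_one] using this

lemma consCentered_mem_reducedSpan {R : MulSeries K B} {x : A} (l : List B) (b : B)
    {m : GapFunctional K A B × A} (hm : IsReduced j Φ Ψ S k R x m) :
    consCentered j Ψ x l b m ∈ reducedSpan j Φ Ψ S k R x :=
  add_mem (consWord_mem_reducedSpan l b hm) (consWord_mem_reducedSpan [] _ hm)

lemma consLetter_eq_centered (j : B →ₐ[K] A) (Ψ : A →ₗ[K] B) (a : A) (m : GapFunctional K A B × A) :
    consLetter a m = consLetter (a - j (Ψ a)) m + consLetter (j (Ψ a)) m := by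
  rw [← consLetter_add, sub_add_cancel]

lemma IsReduced.consLetter_mem (h : UnitalCFree j Φ Ψ S) (hΨ : IsUnitalCondExp j Ψ)
    {R : MulSeries K B} {x : A} {m : GapFunctional K A B × A}
    (hm : IsReduced j Φ Ψ S k R x m) {a : A} (ha : a ∈ S k) :
    consLetter a m ∈ reducedSpan j Φ Ψ S k R x := by
  have hempty : ∀ a ∈ S k, consLetter a (emptyWord R Φ) ∈ reducedSpan j Φ Ψ S k R x := by
    intro a ha
    rw [consLetter_eq_centered j Ψ]
    exact add_mem
      (IsReduced.single _ (sub_coe_mem h ha) (hΨ.apply_sub_coe a)).mem_reducedSpan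
      (consLetter_coe_mem_reducedSpan _ IsReduced.empty.mem_reducedSpan)
  cases hm with
  | empty => exact hempty a ha
  | single c hc hc0 =>
    rw [consLetter_consLetter]
    exact hempty _ ((S k).mul_mem ha hc)
  | cons c hc hc0 l b m hm =>
    rw [consLetter_consLetter, consLetter_eq_centered j Ψ]
    exact add_mem (IsReduced.cons _ (sub_coe_mem h ((S k).mul_mem ha hc))
        (hΨ.apply_sub_coe _) l b m hm).mem_reducedSpan
      (consLetter_coe_mem_reducedSpan _ (consCentered_mem_reducedSpan l b hm))

/-- Left multiplication of `p w` by `a ∈ S k`: split `a` and `p` into a centered part and an element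
of `B`, and merge the letters of `S k` which become adjacent. -/
lemma consLetter_mem_reducedSpan (h : UnitalCFree j Φ Ψ S) (hΨ : IsUnitalCondExp j Ψ)
    {R : MulSeries K B} {x : A} {a : A} (ha : a ∈ S k) {y : GapFunctional K A B × A}
    (hy : y ∈ reducedSpan j Φ Ψ S k R x) :
    consLetter a y ∈ reducedSpan j Φ Ψ S k R x := by
  refine map_mem_reducedSpan _ (fun l b m hm => ?_) hy
  have h1 : consWord j Ψ x l b m = consCentered j Ψ x l b m +
      consLetter (j (Ψ (wordVal j x l b))) m := by
    rw [consCentered, LinearMap.add_apply, add_assoc, ← consLetter_add, ← map_add,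
      neg_add_cancel, map_zero]
    have h0 : consLetter (0 : A) m = 0 := by
      refine Prod.ext ?_ (zero_mul _)
      ext t u
      simp [consLetter]
    rw [h0, add_zero]
  rw [consLetter_eq_centered j Ψ]
  refine add_mem ?_ (consLetter_coe_mem_reducedSpan _ (consWord_mem_reducedSpan l b hm))
  rw [h1, map_add, consLetter_consLetter]
  exact add_mem
    (IsReduced.cons _ (sub_coe_mem h ha) (hΨ.apply_sub_coe a) l b m hm).mem_reducedSpan
    (hm.consLetter_mem h hΨ ((S k).mul_mem (sub_coe_mem h ha) (h.coe_mem k _)))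

/-- The moments `Φ (x w)` are the sums over the blocks which start at the first letter, for all
words `w` in `reducedSpan`: both sides split off the factor after the initial word in `x`. -/
lemma apply_mul_snd_of_mem_reducedSpan (h : UnitalCFree j Φ Ψ S) (hΦ : IsUnitalCondExp j Φ)
    (hΨ : IsUnitalCondExp j Ψ) (hik : i ≠ k) {x : A} (hx : x ∈ S i) {R : MulSeries K B}
    (hR : IsCR (unitalMomentSeries j Φ x) (unitalMomentSeries j Ψ x) R)
    {y : GapFunctional K A B × A} (hy : y ∈ reducedSpan j Φ Ψ S k R x) :
    Φ (x * y.2) = y.1 1 1 := by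
  induction hy using Submodule.span_induction with
  | mem y hy =>
    obtain ⟨l, b, m, hm, rfl⟩ := hy
    rw [consWord_fst_eq_mul h hx R l b m (Φ m.2) _ _ _ (S i).one_mem,
      consWord_emptyWord_one_one h hΦ hΨ hx hR, consWord_snd, ← mul_assoc,
      hm.apply_mul_snd h hΦ hΨ hik hx ((S i).mul_mem hx (wordVal_mem h hx l b))]
    intro t u hu
    rw [hm.fst_apply h hΨ hik hx t u (mem_alternatingSpan h hΨ hu),
      hm.apply_mul_snd h hΦ hΨ hik hx hu, mul_assoc]
  | zero => simp
  | add y z _ _ hy hz => simp [mul_add, hy, hz]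
  | smul t y _ hy => simp [hy]

/-! ### Additivity in the unital case -/

/-- Reading `x + y` is reading `x`, which may belong to the block, or `y`, which may not. -/
lemma seqWord_add_mem_reducedSpan (h : UnitalCFree j Φ Ψ S) (hΨ : IsUnitalCondExp j Ψ)
    (R : MulSeries K B) (x : A) {y : A} (hy : y ∈ S k) (n : ℕ) (b : ℕ → B) :
    (seqFunctional j R Φ Ψ (x + y) n b, seqWord j (x + y) n b) ∈
      reducedSpan j Φ Ψ S k R x := by
  induction n generalizing b with
  | zero => exact IsReduced.empty.mem_reducedSpan
  | succ n ih =>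
    have h1 := consLetter_coe_mem_reducedSpan (b 0)
      (add_mem (consBlock_mem_reducedSpan (ih (dropSeq 1 b)))
        (consLetter_mem_reducedSpan h hΨ hy (ih (dropSeq 1 b))))
    refine (congrArg (· ∈ reducedSpan j Φ Ψ S k R x) (Prod.ext ?_ ?_)).mp h1
    · ext t u
      simp only [seqFunctional, consLetter, consBlock, LinearMap.prodMap_apply, Prod.mk_add_mk,
        readLetter_apply, readOrClose_apply, LinearMap.add_apply, mul_add, map_add]
      abel
    · simp [seqWord, consLetter, consBlock, add_mul]

lemma apply_mul_seqWord_add (h : UnitalCFree j Φ Ψ S) (hΦ : IsUnitalCondExp j Φ)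
    (hΨ : IsUnitalCondExp j Ψ) (hik : i ≠ k) {x y : A} (hx : x ∈ S i) (hy : y ∈ S k)
    {R : MulSeries K B} (hR : IsCR (unitalMomentSeries j Φ x) (unitalMomentSeries j Ψ x) R)
    (n : ℕ) (b : ℕ → B) :
    Φ (x * seqWord j (x + y) n b) = seqFunctional j R Φ Ψ (x + y) n b 1 1 :=
  apply_mul_snd_of_mem_reducedSpan h hΦ hΨ hik hx hR
    (seqWord_add_mem_reducedSpan h hΨ R x hy n b)

theorem cRSeries_unitalMomentSeries_add (h : UnitalCFree j Φ Ψ S) (hΦ : IsUnitalCondExp j Φ)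
    (hΨ : IsUnitalCondExp j Ψ) (hik : i ≠ k) {x y : A} (hx : x ∈ S i) (hy : y ∈ S k) :
    cRSeries (unitalMomentSeries j Φ (x + y)) (unitalMomentSeries j Ψ (x + y)) =
      cRSeries (unitalMomentSeries j Φ x) (unitalMomentSeries j Ψ x) +
        cRSeries (unitalMomentSeries j Φ y) (unitalMomentSeries j Ψ y) := by
  refine (cRSeries_spec _ _).unique ((isCR_unitalMomentSeries_iff hΦ hΨ _ _).2 fun n b => ?_)
  have h1 := apply_mul_seqWord_add h hΦ hΨ hik hx hy (cRSeries_spec _ _) n b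
  have h2 := apply_mul_seqWord_add h hΦ hΨ hik.symm hy hx (cRSeries_spec _ _) n b
  rw [add_comm y x] at h2
  rw [add_mul, map_add, h1, h2]
  simp only [seqFunctional_one_one hΦ hΨ, outerSum_add_right, add_mul, Finset.sum_add_distrib]
  abel

end UnitalFreeness

/-! ### Passage to unitizations -/

section Extension

variable {K : Type*} [Field K] {B : Type*} [NonUnitalRing B] [Module K B]
  [IsScalarTower K B B] [SMulCommClass K B B]

/-- The series `β'` over the unitization of `B` restricts to the series `β` over `B`. -/
def Extends (β' : MulSeries K (Unitization K B)) (β : MulSeries K B) : Prop :=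
  ∀ (n : ℕ) (b : Fin n → B), β' n (fun i => (b i : Unitization K B)) = (β n b : Unitization K B)

lemma Extends.bracket_inr {γ' : MulSeries K (Unitization K B)} {γ : MulSeries K B}
    (h : Extends γ' γ) (p : ℕ) (b : Fin p → B) :
    bracket γ' p (fun i => (b i : Unitization K B)) = Unitization.inr (bracket γ p b) := by
  match p with
  | 0 => simp [bracket]
  | 1 => simp [bracket]
  | p + 2 =>
    simp only [bracket, Unitization.inr_mul]
    rw [← h]

lemma Extends.term {γ' R' : MulSeries K (Unitization K B)} {γ R : MulSeries K B}
    (hγ : Extends γ' γ) {m : ℕ} (c : Composition m)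
    (hR : ∀ d : Fin c.length → B, R' c.length (fun i => (d i : Unitization K B)) =
      (R c.length d : Unitization K B)) (b : Fin m → B) :
    R' c.length (fun i => bracket γ' (c.blocksFun i)
        ((fun i => (b i : Unitization K B)) ∘ c.embedding i)) =
      Unitization.inr (R c.length (fun i => bracket γ (c.blocksFun i) (b ∘ c.embedding i))) := by
  rw [← hR]
  congr 1
  funext i
  exact hγ.bracket_inr _ _

/-- The transform commutes with the extension of series to the unitization. -/
lemma Extends.cRSeries {β' γ' : MulSeries K (Unitization K B)} {β γ : MulSeries K B}
    (hβ : Extends β' β) (hγ : Extends γ' γ) :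
    Extends (cRSeries β' γ') (cRSeries β γ) := by
  intro n
  induction n using Nat.strong_induction_on with
  | _ n ih =>
    intro b
    have h1 := cRSeries_spec β' γ' n (fun i => (b i : Unitization K B))
    have h2 := congrArg (Unitization.inr (R := K)) (cRSeries_spec β γ n b)
    have hinr : ∀ {ι : Type} (s : Finset ι) (f : ι → B),
        (Unitization.inr (∑ i ∈ s, f i) : Unitization K B) = ∑ i ∈ s, Unitization.inr (f i) :=
      fun s f => map_sum (Unitization.inrNonUnitalAlgHom K B) f s
    rw [outerSum_split] at h1 h2
    simp only [Unitization.inr_add, Unitization.inr_mul, outerSum, hinr] at h1 h2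
    rw [hβ n b, h2] at h1
    have e1 : ∀ c : {c : Composition n // c.length < n}, _ :=
      fun c => hγ.term c.1 (ih _ c.2) b
    have e2 : ∀ (m : Fin n) (c : Composition m), _ :=
      fun m c => hγ.term c (ih _ (lt_of_le_of_lt c.length_le m.isLt))
        (fun i => b (i.castLE m.isLt.le))
    have e3 : ∀ (m : Fin n), _ := fun m => hβ (n - m - 1) (fun i => b ⟨m + 1 + i, by omega⟩)
    simp only [e1, e2, e3] at h1
    simpa using h1.symm

end Extension

section UnitizationMap

variable {K : Type*} [Field K] {A : Type*} [NonUnitalRing A] [Module K A]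
  {B : NonUnitalSubalgebra K A}

/-- The unital extension of a linear map to the unitizations. -/
def unitizationMap (E : A →ₗ[K] B) : Unitization K A →ₗ[K] Unitization K B where
  toFun x := Unitization.inl x.fst + Unitization.inr (E x.snd)
  map_add' x y := by ext <;> simp
  map_smul' t x := by ext <;> simp

@[simp] lemma fst_unitizationMap (E : A →ₗ[K] B) (x : Unitization K A) :
    (unitizationMap E x).fst = x.fst := by
  simp [unitizationMap]

@[simp] lemma snd_unitizationMap (E : A →ₗ[K] B) (x : Unitization K A) :
    (unitizationMap E x).snd = E x.snd := by
  simp [unitizationMap]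

lemma unitizationMap_inr (E : A →ₗ[K] B) (a : A) :
    unitizationMap E (a : Unitization K A) = (E a : Unitization K B) := by
  ext <;> simp

end UnitizationMap

section Unitization

variable {K : Type*} [Field K] {A : Type*} [NonUnitalRing A] [Module K A]
  [IsScalarTower K A A] [SMulCommClass K A A] {B : NonUnitalSubalgebra K A}

/-- The inclusion of the unitization of `B` into the unitization of `A`. -/
noncomputable def unitizationIncl (B : NonUnitalSubalgebra K A) :
    Unitization K B →ₐ[K] Unitization K A :=
  Unitization.lift ((Unitization.inrNonUnitalAlgHom K A).comp (NonUnitalSubalgebraClass.subtype B))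

@[simp] lemma fst_unitizationIncl (b : Unitization K B) : (unitizationIncl B b).fst = b.fst := by
  simp [unitizationIncl, Unitization.lift, Unitization.algebraMap_eq_inl]

@[simp] lemma snd_unitizationIncl (b : Unitization K B) :
    (unitizationIncl B b).snd = (b.snd : A) := by
  simp [unitizationIncl, Unitization.lift, Unitization.algebraMap_eq_inl]

lemma IsCondExp.unitization {E : A →ₗ[K] B} (h : IsCondExp B E) :
    IsUnitalCondExp (unitizationIncl B) (unitizationMap E) where
  map_one := by ext <;> simp
  left_mul b a := by
    ext
    · simp
    · simp [h.left_mul, h.apply_coe]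
  right_mul a b := by
    ext
    · simp
    · simp [h.right_mul, h.apply_coe]

/-- The unitization of a subalgebra, as a subalgebra of the unitization of `A`. -/
def unitizationSubalgebra (S : NonUnitalSubalgebra K A) : Subalgebra K (Unitization K A) where
  carrier := {x | x.snd ∈ S}
  mul_mem' {x y} hx hy := by
    simp only [Set.mem_ofPred_eq, Unitization.snd_mul] at *
    exact add_mem (add_mem (S.smul_mem' _ hy) (S.smul_mem' _ hx)) (mul_mem hx hy)
  add_mem' {x y} hx hy := by
    simp only [Set.mem_ofPred_eq, Unitization.snd_add] at *
    exact add_mem hx hy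
  algebraMap_mem' r := by
    simp [Unitization.algebraMap_eq_inl]

lemma mem_unitizationSubalgebra {S : NonUnitalSubalgebra K A} {x : Unitization K A} :
    x ∈ unitizationSubalgebra S ↔ x.snd ∈ S := Iff.rfl

lemma prod_inr_eq_prodNE {R : Type*} [NonUnitalRing R] [Module K R] [IsScalarTower K R R]
    [SMulCommClass K R R] (a : R) (l : List R) :
    ((a :: l).map (Unitization.inr (R := K))).prod = Unitization.inr (prodNE a l) := by
  induction l generalizing a with
  | nil => simp [prodNE]
  | cons b l ih =>
    rw [List.map_cons, List.prod_cons, ih]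
    simp [prodNE]

/-- A centered word in the unitizations is a centered word in the algebras themselves. -/
lemma isCenteredAlternating_of_unitization {Ψ : A →ₗ[K] B} {ι : Type*}
    {S : ι → NonUnitalSubalgebra K A} {w : List (ι × Unitization K A)}
    (hc : w.IsChain (fun p q => p.1 ≠ q.1))
    (hm : ∀ p ∈ w, p.2 ∈ unitizationSubalgebra (S p.1) ∧ unitizationMap Ψ p.2 = 0) :
    IsCenteredAlternating Ψ S (w.map fun p => (p.1, p.2.snd)) ∧
      ∀ p ∈ w, p.2 = (p.2.snd : Unitization K A) := by
  refine ⟨⟨?_, ?_⟩, ?_⟩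
  · rw [List.isChain_map]
    exact hc
  · intro q hq
    obtain ⟨p, hp, rfl⟩ := List.mem_map.1 hq
    refine ⟨(hm p hp).1, ?_⟩
    simpa using congrArg (fun x => x.snd) (hm p hp).2
  · intro p hp
    ext
    · simpa using congrArg (fun x => x.fst) (hm p hp).2
    · simp

lemma CFreeSubalgebras.unitization {Φ Ψ : A →ₗ[K] B} {ι : Type*}
    {S : ι → NonUnitalSubalgebra K A} (h : CFreeSubalgebras Φ Ψ S)
    (hB : ∀ i, B ≤ S i) :
    UnitalCFree (unitizationIncl B) (unitizationMap Φ) (unitizationMap Ψ)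
      (fun i => unitizationSubalgebra (S i)) := by
  have hprod : ∀ (p : ι × Unitization K A) (w : List (ι × Unitization K A)),
      (∀ q ∈ p :: w, q.2 = (q.2.snd : Unitization K A)) →
      ((p :: w).map Prod.snd).prod =
        Unitization.inr (prodNE p.2.snd (w.map fun q => q.2.snd)) := by
    intro p w hw
    rw [← prod_inr_eq_prodNE (K := K)]
    congr 1
    have h1 : (p :: w).map Prod.snd = (p :: w).map fun q => (q.2.snd : Unitization K A) :=
      List.map_congr_left hw
    rw [h1]
    simp
  refine ⟨?_, ?_, ?_⟩
  · intro i b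
    rw [mem_unitizationSubalgebra, snd_unitizationIncl]
    exact hB i b.snd.2
  · intro w hw hc hm
    obtain ⟨p, w, rfl⟩ := List.exists_cons_of_ne_nil hw
    obtain ⟨h1, h2⟩ := isCenteredAlternating_of_unitization hc hm
    have h3 := h.free _ _ h1
    rw [hprod p w h2, unitizationMap_inr]
    simp only [List.map_map] at h3
    exact (congrArg _ h3).trans (Unitization.inr_zero K)
  · intro w hw hc hm
    obtain ⟨p, w, rfl⟩ := List.exists_cons_of_ne_nil hw
    obtain ⟨h1, h2⟩ := isCenteredAlternating_of_unitization hc hm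
    have h3 := h.factor _ _ h1
    rw [hprod p w h2, unitizationMap_inr]
    simp only [List.map_map] at h3
    refine (congrArg _ h3).trans ?_
    rw [← prod_inr_eq_prodNE (K := K)]
    congr 1
    have h4 : ((p :: w).map fun q => unitizationMap Φ q.2) =
        (p :: w).map fun q => (Φ q.2.snd : Unitization K B) := by
      refine List.map_congr_left fun q hq => ?_
      rw [h2 q hq, unitizationMap_inr]
      simp
    rw [h4]
    simp

lemma inr_word (X : A) (n : ℕ) (b : Fin n → B) :
    Unitization.inr (word X n b) = (X : Unitization K A) *
      (List.ofFn fun i => unitizationIncl B (b i : Unitization K B) * (X : Unitization K A)).prod := by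
  have hj : ∀ b : B, unitizationIncl B (b : Unitization K B) = ((b : A) : Unitization K A) := by
    intro b
    ext <;> simp
  induction n with
  | zero => simp [word]
  | succ n ih =>
    have h := ih (Fin.tail b)
    simp only [Fin.tail] at h
    rw [List.ofFn_succ, List.prod_cons, mul_assoc, ← h, hj, word, Unitization.inr_mul,
      Unitization.inr_mul, mul_assoc]

lemma extends_momentSeries (E : A →ₗ[K] B) (X : A) :
    Extends (unitalMomentSeries (unitizationIncl B) (unitizationMap E) (X : Unitization K A))
      (momentSeries E X) := by
  intro n b
  rw [unitalMomentSeries_apply, ← inr_word, unitizationMap_inr]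
  rfl

lemma extends_cRTransform (Φ Ψ : A →ₗ[K] B) (X : A) :
    Extends (cRSeries
      (unitalMomentSeries (unitizationIncl B) (unitizationMap Φ) (X : Unitization K A))
      (unitalMomentSeries (unitizationIncl B) (unitizationMap Ψ) (X : Unitization K A)))
      (cRTransform Φ Ψ X) :=
  (extends_momentSeries Φ X).cRSeries (extends_momentSeries Ψ X)

end Unitization

end CFreeProb

theorem theorem3p6 {K : Type*} [Field K] {A : Type*} [NonUnitalRing A] [Module K A]
    [IsScalarTower K A A] [SMulCommClass K A A] (B : NonUnitalSubalgebra K A)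
    (Φ Ψ : A →ₗ[K] B) (hΦ : CFreeProb.IsCondExp B Φ) (hΨ : CFreeProb.IsCondExp B Ψ) (X Y : A)
    (hXY : CFreeProb.CFree Φ Ψ ![X, Y]) :
    CFreeProb.cRTransform Φ Ψ (X + Y) =
      CFreeProb.cRTransform Φ Ψ X + CFreeProb.cRTransform Φ Ψ Y := by
  have hfree := hXY.unitization fun i b hb =>
    NonUnitalAlgebra.subset_adjoin K (Set.mem_union_left _ hb)
  have hX : (X : Unitization K A) ∈ CFreeProb.unitizationSubalgebra
      (NonUnitalAlgebra.adjoin K ((B : Set A) ∪ {![X, Y] 0})) :=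
    NonUnitalAlgebra.subset_adjoin K (Set.mem_union_right _ rfl)
  have hY : (Y : Unitization K A) ∈ CFreeProb.unitizationSubalgebra
      (NonUnitalAlgebra.adjoin K ((B : Set A) ∪ {![X, Y] 1})) :=
    NonUnitalAlgebra.subset_adjoin K (Set.mem_union_right _ rfl)
  have h := CFreeProb.cRSeries_unitalMomentSeries_add hfree hΦ.unitization hΨ.unitization
    zero_ne_one hX hY
  rw [← Unitization.inr_add] at h
  funext n
  ext b
  have hb := congrArg (fun R => (R n fun i => (b i : Unitization K B))) h
  simp only [Pi.add_apply, add_apply] at hb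
  rw [CFreeProb.extends_cRTransform, CFreeProb.extends_cRTransform,
    CFreeProb.extends_cRTransform, ← Unitization.inr_add] at hb
  exact congrArg Subtype.val (Unitization.inr_injective hb)
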